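/- A compact matrix quantum group is a pair $(A,u)$ consisting of a unital $C^*$-algebra $A$ and a matrix $u=(u_{i,j})\in M_n(A)$, for some positive integer $n$, such that 1. $A$ is generated, as a unital $C^*$-algebra, by the entries $u_{i,j}$, $1\le i,j\le n$; 2. $u$ and its transpose $u^\top=(u_{j,i})$ are invertible in $M_n(A)$; 3. there is a $*$-homomorphism $\Delta:A\to A\otimes_{\min}A$ into the minimal (spatial) $C^*$-tensor product with $\Delta(u_{i,j})=\sum_{k=1}^n u_{i,k}\otimes u_{k,j}$ for all $i,j$. **Theorem (Fundamental Theorem of Compact Matrix Quantum Groups).** Let $(A,u)$ be a compact matrix quantum group with $u\in M_n(A)$ and $A\neq 0$. Then $A$ is commutative if and only if there is a compact subgroup $G(n)\subseteq GL(n)=GL_n(\mathbb{C})$ such that $A$ is $*$-isomorphic to $C(G(n))$, the $C^*$-algebra of continuous complex-valued functions on $G(n)$. -/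

import Mathlib

noncomputable section

open scoped TensorProduct ComplexOrder

namespace CMQG

/-! ### The Hilbert space tensor product of two operators -/

section Operators

variable {H K : Type*} [NormedAddCommGroup H] [InnerProductSpace ℂ H]
  [NormedAddCommGroup K] [InnerProductSpace ℂ K]

/-- The Hilbert space tensor product of `H` and `K`: the completion of the algebraic tensor product
for the inner product `⟪x ⊗ y, x' ⊗ y'⟫ = ⟪x, x'⟫ * ⟪y, y'⟫`. -/
def HilbertTensor (H K : Type*) [NormedAddCommGroup H] [InnerProductSpace ℂ H]
    [NormedAddCommGroup K] [InnerProductSpace ℂ K] : Type _ :=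
  UniformSpace.Completion (H ⊗[ℂ] K)

instance : NormedAddCommGroup (HilbertTensor H K) :=
  inferInstanceAs (NormedAddCommGroup (UniformSpace.Completion (H ⊗[ℂ] K)))

instance : InnerProductSpace ℂ (HilbertTensor H K) :=
  inferInstanceAs (InnerProductSpace ℂ (UniformSpace.Completion (H ⊗[ℂ] K)))

instance : CompleteSpace (HilbertTensor H K) :=
  inferInstanceAs (CompleteSpace (UniformSpace.Completion (H ⊗[ℂ] K)))

/-- The isometric inclusion of the algebraic tensor product in its completion. -/
def toHilbertTensor : H ⊗[ℂ] K →ₗᵢ[ℂ] HilbertTensor H K :=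
  UniformSpace.Completion.toComplₗᵢ

lemma denseRange_toHilbertTensor : DenseRange (toHilbertTensor : H ⊗[ℂ] K → HilbertTensor H K) :=
  UniformSpace.Completion.denseRange_coe

lemma norm_sq_sum_tmul {ι : Type*} [Fintype ι] (x : ι → H) {e : ι → K} (he : Orthonormal ℂ e) :
    ‖∑ i, x i ⊗ₜ[ℂ] e i‖ ^ 2 = ∑ i, ‖x i‖ ^ 2 := by
  classical
  have h : inner ℂ (∑ i, x i ⊗ₜ[ℂ] e i) (∑ i, x i ⊗ₜ[ℂ] e i) = ∑ i, inner ℂ (x i) (x i) := by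
    simp [sum_inner, inner_sum, orthonormal_iff_ite.mp he]
  have h2 := congrArg Complex.re h
  simp only [Complex.re_sum] at h2
  simp only [← inner_self_eq_norm_sq (𝕜 := ℂ)]
  exact h2

lemma exists_eq_sum_tmul_orthonormal (z : H ⊗[ℂ] K) :
    ∃ (n : ℕ) (x : Fin n → H) (e : Fin n → K), Orthonormal ℂ e ∧ z = ∑ i, x i ⊗ₜ[ℂ] e i := by
  obtain ⟨H', K', _, _, hz⟩ := TensorProduct.exists_finite_submodule_of_setFinite {z}
    (Set.finite_singleton z)
  obtain ⟨y, rfl⟩ := Set.singleton_subset_iff.mp hz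
  let b := stdOrthonormalBasis ℂ K'
  refine ⟨_, fun i => (TensorProduct.rid ℂ H'
    ((b.toBasis.coord i).lTensor H' y) : H'), fun i => (b i : K),
    b.orthonormal.comp_linearIsometry K'.subtypeₗᵢ, ?_⟩
  induction y with
  | zero => simp
  | add a c ha hc =>
    rw [map_add, ha (by simp), hc (by simp), ← Finset.sum_add_distrib]
    simp [TensorProduct.add_tmul]
  | tmul a c =>
    simp only [TensorProduct.mapIncl, TensorProduct.map_tmul, LinearMap.lTensor_tmul,
      TensorProduct.rid_tmul, Submodule.subtype_apply, Submodule.coe_smul,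
      TensorProduct.smul_tmul]
    rw [← TensorProduct.tmul_sum]
    congr 1
    conv_lhs => rw [← b.toBasis.sum_repr c]
    simp

lemma norm_rTensor_le (T : H →L[ℂ] H) (z : H ⊗[ℂ] K) :
    ‖(T : H →ₗ[ℂ] H).rTensor K z‖ ≤ ‖T‖ * ‖z‖ := by
  obtain ⟨n, x, e, he, rfl⟩ := exists_eq_sum_tmul_orthonormal z
  rw [← sq_le_sq₀ (by positivity) (by positivity), mul_pow, norm_sq_sum_tmul x he]
  simp only [map_sum, LinearMap.rTensor_tmul]
  rw [norm_sq_sum_tmul _ he, Finset.mul_sum]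
  refine Finset.sum_le_sum fun i _ => ?_
  rw [← mul_pow]
  exact pow_le_pow_left₀ (norm_nonneg _) (T.le_opNorm _) 2

lemma norm_lTensor_le (S : K →L[ℂ] K) (z : H ⊗[ℂ] K) :
    ‖(S : K →ₗ[ℂ] K).lTensor H z‖ ≤ ‖S‖ * ‖z‖ := by
  have h := norm_rTensor_le S (TensorProduct.comm ℂ H K z)
  rw [TensorProduct.norm_comm, ← LinearMap.comm_comp_lTensor_comp_comm_eq] at h
  simpa using h

/-- The operator `T ⊗ S` on the algebraic tensor product `H ⊗ K`. -/
def algTensorOp (T : H →L[ℂ] H) (S : K →L[ℂ] K) : H ⊗[ℂ] K →L[ℂ] H ⊗[ℂ] K :=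
  (TensorProduct.map (T : H →ₗ[ℂ] H) (S : K →ₗ[ℂ] K)).mkContinuous (‖T‖ * ‖S‖) fun z => by
    rw [← LinearMap.rTensor_comp_lTensor, LinearMap.comp_apply, mul_assoc]
    exact (norm_rTensor_le T _).trans
      (mul_le_mul_of_nonneg_left (norm_lTensor_le S z) (norm_nonneg _))

/-- The bounded operator `T ⊗ S` on the Hilbert space tensor product of `H` and `K`. -/
def tensorOp (T : H →L[ℂ] H) (S : K →L[ℂ] K) : HilbertTensor H K →L[ℂ] HilbertTensor H K :=
  (algTensorOp T S).completion

lemma tensorOp_tmul (T : H →L[ℂ] H) (S : K →L[ℂ] K) (x : H) (y : K) :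
    tensorOp T S (toHilbertTensor (x ⊗ₜ[ℂ] y)) = toHilbertTensor (T x ⊗ₜ[ℂ] S y) :=
  (algTensorOp T S).completion_apply_coe (x ⊗ₜ[ℂ] y)

end Operators

/-! ### The universal representation -/

section Universal

section Ordered

variable (A : Type*) [CStarAlgebra A] [PartialOrder A] [StarOrderedRing A]

/-- The Hilbert space direct sum of the GNS spaces of all positive linear functionals on `A`. -/
abbrev GNSSum : Type _ := lp (fun f : A →ₚ[ℂ] ℂ => f.GNS) 2

variable {A} in
/-- The direct sum of the GNS representations, applied to one element: the operator that acts on the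
summand of `f` by the GNS representation of `f`. -/
def gnsSumOp (a : A) : GNSSum A →L[ℂ] GNSSum A :=
  lp.mapCLM 2 (fun f : A →ₚ[ℂ] ℂ => f.gnsStarAlgHom a) (norm_nonneg a)
    fun f => NonUnitalStarAlgHom.norm_apply_le f.gnsNonUnitalStarAlgHom a

variable {A} in
lemma gnsSumOp_apply (a : A) (v : GNSSum A) (f : A →ₚ[ℂ] ℂ) :
    gnsSumOp a v f = f.gnsStarAlgHom a (v f) := rfl

/-- The direct sum of the GNS representations of all positive linear functionals. -/
def gnsSumRep : A →⋆ₐ[ℂ] (GNSSum A →L[ℂ] GNSSum A) where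
  toFun := gnsSumOp
  map_one' := by
    ext v f
    simp only [gnsSumOp_apply, map_one, one_apply_eq_self]
  map_mul' a b := by
    ext v f
    simp only [gnsSumOp_apply, map_mul, mul_apply_eq_comp]
  map_zero' := by
    ext v f
    simp only [gnsSumOp_apply, map_zero, zero_apply]
    rfl
  map_add' a b := by
    ext v f
    simp only [gnsSumOp_apply, map_add, add_apply]
    rfl
  commutes' r := by
    ext v f
    simp only [gnsSumOp_apply, Algebra.algebraMap_eq_smul_one, map_smul, map_one,
      smul_apply, one_apply_eq_self]
    rfl
  map_star' a := by
    refine (ContinuousLinearMap.eq_adjoint_iff _ _).mpr fun v w => ?_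
    simp only [lp.inner_eq_tsum]
    refine tsum_congr fun f => ?_
    rw [gnsSumOp_apply, gnsSumOp_apply, map_star, ContinuousLinearMap.star_eq_adjoint,
      ContinuousLinearMap.adjoint_inner_left]

end Ordered

variable (A : Type*) [CStarAlgebra A]

/-- The Hilbert space of the universal representation of a unital C⋆-algebra `A`, which carries its
canonical order: `0 ≤ a` if and only if `a` is self-adjoint with nonnegative spectrum. -/
abbrev UniversalSpace : Type _ :=
  letI := CStarAlgebra.spectralOrder A
  haveI := CStarAlgebra.spectralOrderedRing A
  GNSSum A

/-- The universal representation of a unital C⋆-algebra `A`. -/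
def universalRep : A →⋆ₐ[ℂ] (UniversalSpace A →L[ℂ] UniversalSpace A) :=
  letI := CStarAlgebra.spectralOrder A
  haveI := CStarAlgebra.spectralOrderedRing A
  gnsSumRep A

variable {A} in
/-- Positive linear functionals detect nonzero positive elements. -/
lemma exists_positive_apply_ne_zero [PartialOrder A] [StarOrderedRing A] {h : A} (hh : 0 ≤ h)
    (h0 : h ≠ 0) : ∃ f : A →ₚ[ℂ] ℂ, f h ≠ 0 := by
  have hmem : -h ∉ ProperCone.positive ℝ A := fun hm =>
    h0 (le_antisymm (neg_nonneg.mp (ProperCone.mem_positive.mp hm)) hh)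
  obtain ⟨g, hg, hgh⟩ := ProperCone.hyperplane_separation_point _ hmem
  let F : A →ₗ[ℂ] ℂ :=
    { toFun := fun a => (g (realPart a : A) : ℂ) + Complex.I * (g (imaginaryPart a : A) : ℂ)
      map_add' := fun a b => by
        simp; ring
      map_smul' := fun c a => by
        simp [realPart_smul, imaginaryPart_smul, Complex.ext_iff] }
  have hF : ∀ a : A, IsSelfAdjoint a → F a = g a := fun a ha => by
    simp [F, ha.coe_realPart, ha.imaginaryPart]
  refine ⟨PositiveLinearMap.mk₀ F fun a ha => ?_, ?_⟩
  · rw [hF a (IsSelfAdjoint.of_nonneg ha)]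
    exact_mod_cast hg a (ProperCone.mem_positive.mpr ha)
  · have : F h ≠ 0 := by
      rw [hF h (IsSelfAdjoint.of_nonneg hh)]
      rw [map_neg] at hgh
      exact_mod_cast (neg_neg_iff_pos.mp hgh).ne'
    exact this

lemma gnsSumRep_injective [PartialOrder A] [StarOrderedRing A] :
    Function.Injective (gnsSumRep A) := by
  classical
  refine (injective_iff_map_eq_zero _).mpr fun a ha => ?_
  by_contra hne
  obtain ⟨f, hf⟩ := exists_positive_apply_ne_zero (star_mul_self_nonneg a)
    (fun h => hne (CStarRing.star_mul_self_eq_zero_iff a |>.mp h))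
  apply hf
  have h1 : gnsSumOp a (lp.single 2 f ((f.toPreGNS 1 : f.PreGNS) : f.GNS)) f = 0 := by
    change gnsSumRep A a _ f = 0
    rw [ha]
    rfl
  rw [gnsSumOp_apply, lp.single_apply_self, PositiveLinearMap.gnsStarAlgHom_apply] at h1
  change f.gnsNonUnitalStarAlgHom a _ = 0 at h1
  rw [PositiveLinearMap.gnsNonUnitalStarAlgHom_apply_coe] at h1
  have h2 := f.preGNS_norm_sq (f.leftMulMapPreGNS a (f.toPreGNS 1))
  rw [← UniformSpace.Completion.norm_coe, h1] at h2
  simpa using h2.symm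

/-- The universal representation is faithful. -/
theorem universalRep_injective : Function.Injective (universalRep A) :=
  letI := CStarAlgebra.spectralOrder A
  haveI := CStarAlgebra.spectralOrderedRing A
  gnsSumRep_injective A

end Universal

/-! ### The minimal tensor product and compact matrix quantum groups -/

section Spatial

variable {A B H K : Type*} [CStarAlgebra A] [CStarAlgebra B]
  [NormedAddCommGroup H] [InnerProductSpace ℂ H] [CompleteSpace H]
  [NormedAddCommGroup K] [InnerProductSpace ℂ K] [CompleteSpace K]

/-- The spatial tensor product of the images of two representations: the closure, in the bounded
operators on the Hilbert space tensor product, of the ⋆-algebra spanned by the operators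
`π a ⊗ ρ b`. -/
def spatialTensor (π : A →⋆ₐ[ℂ] (H →L[ℂ] H)) (ρ : B →⋆ₐ[ℂ] (K →L[ℂ] K)) :
    StarSubalgebra ℂ (HilbertTensor H K →L[ℂ] HilbertTensor H K) :=
  (StarAlgebra.adjoin ℂ
    (Set.range fun p : A × B => tensorOp (π p.1) (ρ p.2))).topologicalClosure

end Spatial

section Minimal

/-- The minimal tensor product `A ⊗_min B` of two unital C⋆-algebras, realised on the tensor product
of the spaces of two faithful representations, namely the universal ones. -/
abbrev MinTensor (A B : Type*) [CStarAlgebra A] [CStarAlgebra B] : Type _ :=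
  spatialTensor (universalRep A) (universalRep B)

/-- `A ⊗_min B` is a unital C⋆-algebra for the inherited operations and norm. -/
@[reducible]
def MinTensor.cstarAlgebra (A B : Type*) [CStarAlgebra A] [CStarAlgebra B] :
    CStarAlgebra (MinTensor A B) :=
  haveI : IsClosed (spatialTensor (universalRep A) (universalRep B) :
      Set (HilbertTensor (UniversalSpace A) (UniversalSpace B) →L[ℂ]
        HilbertTensor (UniversalSpace A) (UniversalSpace B))) :=
    StarSubalgebra.isClosed_topologicalClosure _
  StarSubalgebra.cstarAlgebra _

variable {A B : Type*} [CStarAlgebra A] [CStarAlgebra B]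

/-- The elementary tensor `a ⊗ b` as an element of `A ⊗_min B`. -/
def minTmul (a : A) (b : B) : MinTensor A B :=
  ⟨tensorOp (universalRep A a) (universalRep B b),
    StarSubalgebra.le_topologicalClosure _ (StarAlgebra.subset_adjoin ℂ _ ⟨(a, b), rfl⟩)⟩

end Minimal

/-- `(A, u)` is a compact matrix quantum group, for a unital C⋆-algebra `A` and an `n × n` matrix `u`
over `A`. The ⋆-homomorphism `Δ` is not assumed to preserve the unit: it does so automatically. -/
structure IsCompactMatrixQuantumGroup {A : Type*} [CStarAlgebra A] {n : ℕ}
    (u : Matrix (Fin n) (Fin n) A) : Prop where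
  /-- The size of the matrix is positive. -/
  size_pos : 0 < n
  /-- `A` is generated, as a unital C⋆-algebra, by the entries of `u`. -/
  generated : (StarAlgebra.adjoin ℂ {a : A | ∃ i j, a = u i j}).topologicalClosure = ⊤
  /-- `u` is invertible in `M_n(A)`. -/
  isUnit : IsUnit u
  /-- The transpose of `u` is invertible in `M_n(A)`. -/
  isUnit_transpose : IsUnit u.transpose
  /-- There is a ⋆-homomorphism `Δ : A → A ⊗_min A` with `Δ(u i j) = ∑ k, u i k ⊗ u k j`. -/
  comultiplication : ∃ Δ : A →⋆ₙₐ[ℂ] MinTensor A A,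
    ∀ i j, Δ (u i j) = ∑ k, minTmul (u i k) (u k j)

end CMQG

end

noncomputable section

open scoped TensorProduct ComplexOrder

/-! For commutative `A`, Gelfand duality gives `A ≅ C(X)` with `X` the character space, so `X` has
to be realised as a compact matrix group. The map `χ ↦ (χ (u i j))` lands in `GL_n` because `u` is
invertible, and it is injective because the entries generate `A`; its image is compact
(`continuous_evalGL`, `evalGL_injective`). The product of two points of the image is the point of
`(χ ⊗ ψ) ∘ Δ` (`evalGL_mul_mem_range`), and a nonempty compact subsemigroup of a Hausdorff group is
a subgroup, so neither counit nor antipode has to be constructed.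

The delicate point is that `χ ⊗ ψ` must exist on the concrete algebra `MinTensor A A`. Each
character is a vector state at a common unit eigenvector of the universal representation. If `x` and
`y` are such eigenvectors, then `x ⊗ y` is one for the whole spatial tensor product, and its vector
state is multiplicative. -/

namespace CMQG

/-! ### Common eigenvectors and multiplicative vector states. -/

section EigenvectorCharacter

variable {H : Type*} [NormedAddCommGroup H] [InnerProductSpace ℂ H]

/-- The algebra of operators with `v` as an eigenvector acts on `v` through a character. -/
def eigenvectorCharacter {S : Type*} [SetLike S (H →L[ℂ] H)] [SubringClass S (H →L[ℂ] H)]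
    [SMulMemClass S ℂ (H →L[ℂ] H)] (s : S) (v : H) (hv : ‖v‖ = 1)
    (hs : ∀ T ∈ s, ∃ c : ℂ, T v = c • v) : s →ₙₐ[ℂ] ℂ where
  toFun T := inner ℂ v ((T : H →L[ℂ] H) v)
  map_smul' c T := by simp
  map_zero' := by simp
  map_add' T T' := by simp
  map_mul' T T' := by
    obtain ⟨c, hc⟩ := hs T T.2
    obtain ⟨c', hc'⟩ := hs T' T'.2
    simp [hc, hc', hv, mul_comm]

variable [CompleteSpace H]

/-- The operators `T` such that `v` is an eigenvector of both `T` and its adjoint. -/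
def eigenvectorStarSubalgebra (v : H) : StarSubalgebra ℂ (H →L[ℂ] H) where
  -- The condition on the adjoint is what makes the set stable under `star`.
  carrier := {T | T v ∈ ℂ ∙ v ∧ star T v ∈ ℂ ∙ v}
  mul_mem' := by
    rintro S T ⟨hS, hS'⟩ ⟨hT, hT'⟩
    obtain ⟨a, ha⟩ := Submodule.mem_span_singleton.mp hT
    obtain ⟨b, hb⟩ := Submodule.mem_span_singleton.mp hS'
    refine ⟨?_, ?_⟩
    · rw [mul_apply_eq_comp, ← ha, map_smul]
      exact Submodule.smul_mem _ _ hS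
    · rw [star_mul, mul_apply_eq_comp, ← hb, map_smul]
      exact Submodule.smul_mem _ _ hT'
  add_mem' := by
    rintro S T ⟨hS, hS'⟩ ⟨hT, hT'⟩
    exact ⟨Submodule.add_mem _ hS hT, by rw [star_add]; exact Submodule.add_mem _ hS' hT'⟩
  algebraMap_mem' r := by
    refine ⟨?_, ?_⟩
    · rw [Algebra.algebraMap_eq_smul_one]
      exact Submodule.smul_mem _ _ (Submodule.mem_span_singleton_self v)
    · rw [Algebra.algebraMap_eq_smul_one, star_smul, star_one]
      exact Submodule.smul_mem _ _ (Submodule.mem_span_singleton_self v)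
  star_mem' := by
    rintro T ⟨hT, hT'⟩
    exact ⟨hT', by rwa [star_star]⟩

lemma isClosed_eigenvectorStarSubalgebra (v : H) :
    IsClosed (eigenvectorStarSubalgebra v : Set (H →L[ℂ] H)) := by
  have hc : IsClosed ((ℂ ∙ v : Submodule ℂ H) : Set H) := Submodule.closed_of_finiteDimensional _
  have h1 : Continuous fun T : H →L[ℂ] H => T v := by fun_prop
  exact (hc.preimage h1).inter (hc.preimage (h1.comp continuous_star))

end EigenvectorCharacter

/-! ### Eigenvectors of the spatial tensor product. -/

section TensorEigenvector

variable {H K : Type*} [NormedAddCommGroup H] [InnerProductSpace ℂ H] [CompleteSpace H]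
  [NormedAddCommGroup K] [InnerProductSpace ℂ K] [CompleteSpace K]

lemma star_tensorOp (T : H →L[ℂ] H) (S : K →L[ℂ] K) :
    star (tensorOp T S) = tensorOp (star T) (star S) := by
  refine Eq.symm ((ContinuousLinearMap.eq_adjoint_iff _ _).mpr fun v w => ?_)
  induction v, w using denseRange_toHilbertTensor.induction_on₂ with
  | hp => apply isClosed_eq <;> fun_prop
  | h v w =>
    induction v with
    | zero => simp
    | add v v' hv hv' => simp only [map_add, inner_add_left, hv, hv']
    | tmul x y =>
      induction w with
      | zero => simp
      | add w w' hw hw' => simp only [map_add, inner_add_right, hw, hw']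
      | tmul x' y' =>
        simp only [tensorOp_tmul, LinearIsometry.inner_map_map, TensorProduct.inner_tmul,
          ContinuousLinearMap.star_eq_adjoint, ContinuousLinearMap.adjoint_inner_left]

variable {A B : Type*} [CStarAlgebra A] [CStarAlgebra B]

/-- The generators and their adjoints are elementary tensors of operators with eigenvectors `x` and
`y`, and the operators having `x ⊗ y` as an eigenvector together with their adjoints form a closed
⋆-subalgebra. -/
lemma exists_apply_eq_smul_of_mem_spatialTensor {π : A →⋆ₐ[ℂ] (H →L[ℂ] H)}
    {ρ : B →⋆ₐ[ℂ] (K →L[ℂ] K)} {φ : A → ℂ} {ψ : B → ℂ} {x : H} {y : K}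
    (hx : ∀ a, π a x = φ a • x) (hy : ∀ b, ρ b y = ψ b • y)
    (T : HilbertTensor H K →L[ℂ] HilbertTensor H K) (hT : T ∈ spatialTensor π ρ) :
    ∃ c : ℂ, T (toHilbertTensor (x ⊗ₜ y)) = c • toHilbertTensor (x ⊗ₜ y) := by
  have key : ∀ a b, tensorOp (π a) (ρ b) (toHilbertTensor (x ⊗ₜ[ℂ] y)) ∈
      ℂ ∙ toHilbertTensor (x ⊗ₜ[ℂ] y) := fun a b => by
    rw [tensorOp_tmul, hx, hy, TensorProduct.smul_tmul_smul, map_smul]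
    exact Submodule.smul_mem _ _ (Submodule.mem_span_singleton_self _)
  have hle : spatialTensor π ρ ≤ eigenvectorStarSubalgebra (toHilbertTensor (x ⊗ₜ[ℂ] y)) := by
    refine StarSubalgebra.topologicalClosure_minimal (StarAlgebra.adjoin_le ?_)
      (isClosed_eigenvectorStarSubalgebra _)
    rintro _ ⟨p, rfl⟩
    refine ⟨key _ _, ?_⟩
    rw [star_tensorOp, ← map_star, ← map_star]
    exact key _ _
  obtain ⟨c, hc⟩ := Submodule.mem_span_singleton.mp (hle hT).1
  exact ⟨c, hc.symm⟩

end TensorEigenvector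

/-! ### Characters as vector states of the universal representation. -/

section UniversalEigenvector

open WeakDual

/-- A character is itself a positive functional `f`. In its GNS space the class `e` of `1` satisfies
`‖a e - χ(a) e‖² = χ((a - χ(a))⋆ (a - χ(a))) = 0`; `v` is `e` placed in the summand of `f`. -/
lemma exists_gnsSumRep_eigenvector {A : Type*} [CStarAlgebra A] [PartialOrder A] [StarOrderedRing A]
    (χ : characterSpace ℂ A) :
    ∃ v : GNSSum A, ‖v‖ = 1 ∧ ∀ a, gnsSumRep A a v = χ a • v := by
  classical
  let f : A →ₚ[ℂ] ℂ := PositiveLinearMap.ofClass χ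
  have hf : ∀ a, f a = χ a := fun _ => rfl
  let e : f.PreGNS := f.toPreGNS 1
  have heig : ∀ a, f.leftMulMapPreGNS a e - χ a • e = f.toPreGNS (a - χ a • 1) := fun a => by
    simp [e]
  have hker : ∀ a, χ (a - χ a • 1) = 0 := fun a => by simp
  have hzero : ∀ a, ‖f.leftMulMapPreGNS a e - χ a • e‖ = 0 := fun a => by
    have h := f.preGNS_norm_sq (f.leftMulMapPreGNS a e - χ a • e)
    rw [heig, f.ofPreGNS_toPreGNS, hf, map_mul, hker, mul_zero] at h
    rw [heig]
    exact pow_eq_zero_iff two_ne_zero |>.mp (by exact_mod_cast h)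
  have hnorm : ‖e‖ = 1 := by
    have h := f.preGNS_norm_sq e
    simp only [e, f.ofPreGNS_toPreGNS, hf, star_one, mul_one, map_one] at h
    have h' : ‖e‖ ^ 2 = 1 := by exact_mod_cast h
    exact (pow_eq_one_iff_of_nonneg (norm_nonneg e) two_ne_zero).mp h'
  have hcoe : ∀ a, f.gnsStarAlgHom a (e : f.GNS) = χ a • (e : f.GNS) := fun a => by
    rw [← sub_eq_zero, ← norm_eq_zero, ← hzero a]
    change ‖f.gnsNonUnitalStarAlgHom a (e : f.GNS) - _‖ = _
    rw [f.gnsNonUnitalStarAlgHom_apply_coe, ← UniformSpace.Completion.coe_smul,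
      ← UniformSpace.Completion.coe_sub, UniformSpace.Completion.norm_coe]
  refine ⟨lp.single 2 f (e : f.GNS), ?_, fun a => ?_⟩
  · rw [lp.norm_single (by norm_num), UniformSpace.Completion.norm_coe, hnorm]
  · ext g
    change gnsSumOp a _ g = _
    rw [gnsSumOp_apply, lp.coeFn_smul, Pi.smul_apply]
    by_cases h : g = f
    · subst h
      rw [lp.single_apply_self, hcoe]
    · rw [lp.single_apply_ne _ _ _ h]
      simp

lemma exists_universalRep_eigenvector {A : Type*} [CStarAlgebra A] (χ : characterSpace ℂ A) :
    ∃ v : UniversalSpace A, ‖v‖ = 1 ∧ ∀ a, universalRep A a v = χ a • v :=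
  letI := CStarAlgebra.spectralOrder A
  haveI := CStarAlgebra.spectralOrderedRing A
  exists_gnsSumRep_eigenvector χ

/-- The product of two characters on the minimal tensor product. -/
lemma exists_minTensor_character {A B : Type*} [CStarAlgebra A] [CStarAlgebra B]
    (χ : characterSpace ℂ A) (ψ : characterSpace ℂ B) :
    ∃ ω : MinTensor A B →ₙₐ[ℂ] ℂ, ∀ a b, ω (minTmul a b) = χ a * ψ b := by
  obtain ⟨x, hx1, hx⟩ := exists_universalRep_eigenvector χ
  obtain ⟨y, hy1, hy⟩ := exists_universalRep_eigenvector ψ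
  have hv : ‖toHilbertTensor (x ⊗ₜ[ℂ] y)‖ = 1 := by
    rw [LinearIsometry.norm_map, TensorProduct.norm_tmul, hx1, hy1, one_mul]
  refine ⟨eigenvectorCharacter _ _ hv (exists_apply_eq_smul_of_mem_spatialTensor hx hy),
    fun a b => ?_⟩
  change inner ℂ _ (tensorOp _ _ _) = _
  rw [tensorOp_tmul, hx, hy, TensorProduct.smul_tmul_smul, map_smul, inner_smul_right,
    inner_self_eq_norm_sq_to_K, hv]
  simp

end UniversalEigenvector

/-! ### The compact matrix group of characters. -/

section CharacterGroup

/-- A nonempty compact subsemigroup of a Hausdorff topological group is closed under inverses. -/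
lemma inv_mem_of_isCompact_of_mul_mem {G : Type*} [Group G] [TopologicalSpace G]
    [IsTopologicalGroup G] [T2Space G] {S : Set G} (hS : IsCompact S)
    (hmul : ∀ x ∈ S, ∀ y ∈ S, x * y ∈ S) {s : G} (hs : s ∈ S) : s⁻¹ ∈ S := by
  -- Applied to `s S` rather than `S`: its idempotent `s * t` must be `1`, which exhibits `s⁻¹ = t`
  -- in `S`.
  obtain ⟨m, ⟨t, ht, rfl⟩, hm⟩ := exists_idempotent_in_compact_subsemigroup
    (fun r : G => continuous_mul_const r) ((s * ·) '' S) ⟨_, s, hs, rfl⟩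
    (hS.image (continuous_const_mul s)) (by
      rintro _ ⟨x, hx, rfl⟩ _ ⟨y, hy, rfl⟩
      exact ⟨x * (s * y), hmul _ hx _ (hmul _ hs _ hy), by simp only [mul_assoc]⟩)
  rwa [inv_eq_of_mul_eq_one_right (mul_eq_left.mp hm)]

/-- A nonempty compact subsemigroup of a Hausdorff topological group, as a subgroup. -/
def subgroupOfIsCompact {G : Type*} [Group G] [TopologicalSpace G]
    [IsTopologicalGroup G] [T2Space G] (S : Set G) (hS : IsCompact S) (hne : S.Nonempty)
    (hmul : ∀ x ∈ S, ∀ y ∈ S, x * y ∈ S) : Subgroup G where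
  carrier := S
  mul_mem' hx hy := hmul _ hx _ hy
  one_mem' := by
    obtain ⟨s, hs⟩ := hne
    rw [← mul_inv_cancel s]
    exact hmul _ hs _ (inv_mem_of_isCompact_of_mul_mem hS hmul hs)
  inv_mem' hx := inv_mem_of_isCompact_of_mul_mem hS hmul hx

open WeakDual

variable {A : Type*} {n : ℕ}

/-- The invertible matrix of values of a character on the entries of an invertible matrix. -/
def evalGL [CStarAlgebra A] (U : (Matrix (Fin n) (Fin n) A)ˣ) (χ : characterSpace ℂ A) :
    GL (Fin n) ℂ :=
  Units.map (CharacterSpace.toAlgHom χ).toRingHom.mapMatrix.toMonoidHom U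

lemma evalGL_apply [CStarAlgebra A] (U : (Matrix (Fin n) (Fin n) A)ˣ) (χ : characterSpace ℂ A)
    (i j : Fin n) : (evalGL U χ : Matrix (Fin n) (Fin n) ℂ) i j = χ (U.1 i j) := rfl

lemma continuous_evalGL [CStarAlgebra A] (U : (Matrix (Fin n) (Fin n) A)ˣ) :
    Continuous (evalGL U) := by
  have h : ∀ a : A, Continuous fun χ : characterSpace ℂ A => χ a := fun a =>
    (eval_continuous a).comp continuous_subtype_val
  -- The topology of the unit group also asks for continuity of the inverse, whose entries are the
  -- values of `χ` on the entries of `U⁻¹`.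
  exact Units.continuous_iff.mpr
    ⟨continuous_matrix fun i j => h _, continuous_matrix fun i j => h _⟩

lemma evalGL_injective [CStarAlgebra A] (U : (Matrix (Fin n) (Fin n) A)ˣ)
    (hU : (StarAlgebra.adjoin ℂ {a : A | ∃ i j, a = U.1 i j}).topologicalClosure = ⊤) :
    Function.Injective (evalGL U) := by
  intro χ ψ h
  have hle : (⊤ : StarSubalgebra ℂ A) ≤ StarAlgHom.equalizer χ ψ := by
    rw [← hU]
    refine StarSubalgebra.topologicalClosure_minimal (StarAlgebra.adjoin_le ?_)
      (isClosed_eq (map_continuous χ) (map_continuous ψ))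
    rintro _ ⟨i, j, rfl⟩
    change χ _ = ψ _
    rw [← evalGL_apply, ← evalGL_apply, h]
  exact DFunLike.ext _ _ fun a => hle (StarSubalgebra.mem_top (x := a))

/-- A nonzero multiplicative functional is a character. -/
lemma exists_character_eq [CStarAlgebra A] (ω : A →ₙₐ[ℂ] ℂ) (h : ω ≠ 0) :
    ∃ χ : characterSpace ℂ A, ∀ a, χ a = ω a := by
  obtain ⟨a, ha⟩ := DFunLike.ne_iff.mp h
  have h1 : ω 1 = 1 := by
    have := map_mul ω 1 a
    rw [one_mul] at this
    exact (mul_eq_right₀ ha).mp this.symm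
  exact ⟨CharacterSpace.equivAlgHom.symm (AlgHom.ofLinearMap (ω : A →ₗ[ℂ] ℂ) h1 (map_mul ω)),
    fun _ => rfl⟩

lemma evalGL_mul_mem_range [CStarAlgebra A] (U : (Matrix (Fin n) (Fin n) A)ˣ)
    (hU : IsCompactMatrixQuantumGroup U.1) (χ ψ : characterSpace ℂ A) :
    evalGL U χ * evalGL U ψ ∈ Set.range (evalGL U) := by
  obtain ⟨Δ, hΔ⟩ := hU.comultiplication
  obtain ⟨ω, hω⟩ := exists_minTensor_character χ ψ
  have hval : ∀ i j, ω (Δ (U.1 i j)) =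
      (evalGL U χ * evalGL U ψ : GL (Fin n) ℂ).1 i j := fun i j => by
    simp only [hΔ, map_sum, hω, Units.val_mul, Matrix.mul_apply, evalGL_apply]
  -- Since `Δ` is not assumed unital, the composite could a priori vanish; then an invertible matrix
  -- of positive size would be zero.
  have hne : ω.comp (Δ : A →ₙₐ[ℂ] MinTensor A A) ≠ 0 := fun h0 => by
    have : Nonempty (Fin n) := Fin.pos_iff_nonempty.mp hU.size_pos
    refine (evalGL U χ * evalGL U ψ).ne_zero (Matrix.ext fun i j => ?_)
    rw [← hval]
    exact DFunLike.congr_fun h0 (U.1 i j)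
  obtain ⟨θ, hθ⟩ := exists_character_eq _ hne
  exact ⟨θ, Units.ext (Matrix.ext fun i j => (hθ _).trans (hval i j))⟩

/-- A commutative compact matrix quantum group is the algebra of functions on a compact matrix
group. -/
theorem exists_starAlgEquiv_of_comm [CommCStarAlgebra A] [Nontrivial A]
    {u : Matrix (Fin n) (Fin n) A} (hu : IsCompactMatrixQuantumGroup u) :
    ∃ G : Subgroup (GL (Fin n) ℂ), IsCompact (G : Set (GL (Fin n) ℂ)) ∧
      Nonempty (A ≃⋆ₐ[ℂ] C(G, ℂ)) := by
  obtain ⟨U, rfl⟩ := hu.isUnit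
  have hcompact := isCompact_range (continuous_evalGL U)
  have hmul : ∀ x ∈ Set.range (evalGL U), ∀ y ∈ Set.range (evalGL U),
      x * y ∈ Set.range (evalGL U) := by
    rintro _ ⟨χ, rfl⟩ _ ⟨ψ, rfl⟩
    exact evalGL_mul_mem_range U hu χ ψ
  -- A continuous injection from a compact space to a Hausdorff space is a closed embedding.
  let e : characterSpace ℂ A ≃ₜ Set.range (evalGL U) :=
    ((continuous_evalGL U).isClosedEmbedding (evalGL_injective U hu.generated)).toHomeomorph
  exact ⟨subgroupOfIsCompact _ hcompact (Set.range_nonempty _) hmul, hcompact,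
    ⟨(gelfandStarTransform A).trans (e.symm.compStarAlgEquiv' ℂ ℂ)⟩⟩

end CharacterGroup

end CMQG

end

theorem mainTheorem4 {A : Type*} [CStarAlgebra A] [Nontrivial A] {n : ℕ}
    (u : Matrix (Fin n) (Fin n) A) (hu : CMQG.IsCompactMatrixQuantumGroup u) :
    (∀ a b : A, a * b = b * a) ↔
      ∃ G : Subgroup (GL (Fin n) ℂ), IsCompact (G : Set (GL (Fin n) ℂ)) ∧
        Nonempty (A ≃⋆ₐ[ℂ] C(G, ℂ)) := by
  refine ⟨fun h => ?_, ?_⟩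
  · let : CommCStarAlgebra A := { ‹CStarAlgebra A› with mul_comm := h }
    exact CMQG.exists_starAlgEquiv_of_comm hu
  · rintro ⟨G, -, ⟨e⟩⟩ a b
    exact e.injective (by rw [map_mul, map_mul, mul_comm])
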